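/- Let $\Bbbk$ be an algebraically closed field of characteristic zero, let $n \ge 0$ and $0 \le d \le 7$ be integers, and let $C_n(\mathbb{M}_d)$ be the affine scheme of $n$-tuples of pairwise commuting $d\times d$ matrices over $\Bbbk$, that is, the closed subscheme of $\mathbb{M}_d^n \simeq \mathbb{A}^{nd^2}$ cut out by the entries of all commutators $x_ix_j - x_jx_i$. An irreducible component of $C_n(\mathbb{M}_d)$ is called elementary if, for every tuple $(y_1,\dots,y_n)$ of commuting matrices over $\Bbbk$ belonging to it, each matrix $y_i$ has precisely one eigenvalue; otherwise it is called non-elementary. Let $(x_1,\dots,x_n)$ be an $n$-tuple of pairwise commuting nilpotent $d\times d$ matrices over $\Bbbk$ such that some linear combination $c_1x_1+\dots+c_nx_n$ with $c_1,\dots,c_n\in\Bbbk$ has nonzero cube. Then the point $(x_1,\dots,x_n)$ of $C_n(\mathbb{M}_d)$ belongs to a non-elementary irreducible component of $C_n(\mathbb{M}_d)$. -/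

import Mathlib

namespace CommutingMatrices

variable (k : Type*) [Field k] (n d : ℕ)

/-- The generic `d × d` matrix number `i`: its `(a, b)` entry is the variable `X (i, a, b)`. -/
noncomputable def genericMatrix (i : Fin n) :
    Matrix (Fin d) (Fin d) (MvPolynomial (Fin n × Fin d × Fin d) k) :=
  Matrix.of fun a b => MvPolynomial.X (i, a, b)

/-- The ideal generated by all entries of all commutators of the generic matrices. -/
noncomputable def commutatorIdeal : Ideal (MvPolynomial (Fin n × Fin d × Fin d) k) :=
  Ideal.span {p | ∃ (i j : Fin n) (a b : Fin d),
    p = (genericMatrix k n d i * genericMatrix k n d j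
      - genericMatrix k n d j * genericMatrix k n d i) a b}

/-- The coordinate ring of the scheme `C_n(M_d)` of commuting `n`-tuples of `d × d` matrices. -/
abbrev CoordinateRing : Type _ :=
  MvPolynomial (Fin n × Fin d × Fin d) k ⧸ commutatorIdeal k n d

/-- The (underlying topological space of the) affine scheme `C_n(M_d)`, with the Zariski
topology. -/
abbrev CommutingScheme : Type _ := PrimeSpectrum (CoordinateRing k n d)

variable {k n d}

/-- Evaluation of polynomials in the matrix entries at a tuple of matrices. -/
noncomputable def evalTuple (x : Fin n → Matrix (Fin d) (Fin d) k) :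
    MvPolynomial (Fin n × Fin d × Fin d) k →+* k :=
  MvPolynomial.eval fun v => x v.1 v.2.1 v.2.2

theorem evalTuple_commutatorIdeal (x : Fin n → Matrix (Fin d) (Fin d) k)
    (hx : ∀ i j, x i * x j = x j * x i) :
    ∀ p ∈ commutatorIdeal k n d, evalTuple x p = 0 := by
  intro p hp
  have hle : commutatorIdeal k n d ≤ RingHom.ker (evalTuple x) := by
    refine Ideal.span_le.2 ?_
    rintro _ ⟨i, j, a, b, rfl⟩
    have h := congrFun (congrFun (hx i j) a) b
    simp only [Matrix.mul_apply] at h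
    simp [RingHom.mem_ker, genericMatrix, evalTuple, Matrix.mul_apply, h]
  exact hle hp

/-- The `k`-point of `C_n(M_d)` given by a commuting tuple `x`: the kernel of evaluation at `x`. -/
noncomputable def point (x : Fin n → Matrix (Fin d) (Fin d) k)
    (hx : ∀ i j, x i * x j = x j * x i) : CommutingScheme k n d :=
  ⟨RingHom.ker (Ideal.Quotient.lift (commutatorIdeal k n d) (evalTuple x)
    (evalTuple_commutatorIdeal x hx)), RingHom.ker_isPrime _⟩

/-- A component `Z` of `C_n(M_d)` is elementary if for all tuples belonging to `Z`, each matrix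
of the tuple has precisely one eigenvalue. -/
def IsElementary (Z : Set (CommutingScheme k n d)) : Prop :=
  ∀ (y : Fin n → Matrix (Fin d) (Fin d) k) (hy : ∀ i j, y i * y j = y j * y i),
    point y hy ∈ Z → ∀ i, ∃! μ : k, Module.End.HasEigenvalue (Matrix.toLin' (y i)) μ

end CommutingMatrices

/-! The tuple is joined, inside `C_n(M_d)`, to a tuple with two distinct eigenvalues by a polynomial
one-parameter family; the closure of such a family lies in one component.

Let `J = ∑ c_i x_i`, with `J ^ (r + 1) = 0 ≠ J ^ r`, so `r ≥ 3`. Choose `e` and `ξ` with `ξ (J ^ l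
e) = δ_{l,r}` for `l ≤ r`. The chain `e, J e, …, J ^ r e` has a `J`-stable complement `W = stableKer
J ξ`, of dimension at most `7 - 4 = 3`. Write `x_i = p_i(J) + y_i` with `y_i e ∈ W`. With `R = ξ ⊗
e`, `E = J ^ r R` and `P = sandwichSum J R r`, the family is `x_i(t) = p_i(J + t E) + (1 - t P)
y_i`. It satisfies `∑ c_i x_i(t) = J + t E`, which at `t = 1` has eigenvalues 0 and 1, whereas
commuting operators with one eigenvalue each only have combinations with one eigenvalue.

Commutativity of the family reduces to a few identities (`commute_deformed`, `exists_deformation`).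
The delicate one is `y_i P y_j = y_j P y_i` (`mul_sandwichSum_mul_comm`), where `dim W ≤ 3` is
essential. -/

/-- The sum `∑ J ^ l * R * J ^ m` over `l + m = s - 1`. -/
def sandwichSum {A : Type*} [Semiring A] (J R : A) (s : ℕ) : A :=
  ∑ l ∈ Finset.range s, J ^ l * R * J ^ (s - 1 - l)

/-! ### Recursions for sandwich sums -/

section Sandwich

variable {A : Type*} [Semiring A] (J R : A)

theorem sandwichSum_succ (s : ℕ) :
    sandwichSum J R (s + 1) = sandwichSum J R s * J + J ^ s * R := by
  unfold sandwichSum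
  rw [Finset.sum_range_succ, Finset.sum_mul]
  congr 1
  · refine Finset.sum_congr rfl fun l hl => ?_
    have hl := Finset.mem_range.1 hl
    rw [mul_assoc _ _ J, ← pow_succ]
    congr 2
    omega
  · simp

/-- Compared with `sandwichSum_succ`, this computes the commutator of `J` with the sandwich sum: `J
^ s * R - R * J ^ s`. -/
theorem sandwichSum_succ' (s : ℕ) :
    sandwichSum J R (s + 1) = J * sandwichSum J R s + R * J ^ s := by
  unfold sandwichSum
  rw [Finset.sum_range_succ', Finset.mul_sum]
  congr 1
  · refine Finset.sum_congr rfl fun l hl => ?_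
    rw [← mul_assoc, ← mul_assoc, ← pow_succ']
    congr 2
    omega
  · simp

end Sandwich

/-! ### Jordan chains and dual functionals -/

section CyclicVectors

variable {K V : Type*} [Field K] [AddCommGroup V] [Module K V]

theorem linearIndependent_jordan_chain {J : Module.End K V} (s : ℕ) {v : V}
    (hv : (J ^ s) v ≠ 0) (hv' : (J ^ (s + 1)) v = 0) :
    LinearIndependent K fun i : Fin (s + 1) => (J ^ (i : ℕ)) v := by
  induction s generalizing v with
  | zero =>
    refine (linearIndependent_unique_iff (ι := Fin 1)).2 ?_
    simpa using hv
  | succ s ih =>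
    have hJv : ∀ n, (J ^ n) (J v) = (J ^ (n + 1)) v := fun n => by
      rw [← Module.End.mul_apply, ← pow_succ]
    have hfun : (fun i : Fin (s + 1 + 1) => (J ^ (i : ℕ)) v)
        = Fin.cons v fun i : Fin (s + 1) => (J ^ (i : ℕ)) (J v) := by
      funext i
      refine Fin.cases ?_ (fun i => ?_) i
      · simp
      · simp [pow_succ]
    rw [hfun, linearIndependent_finCons]
    refine ⟨ih (by rwa [hJv]) (by rwa [hJv]), fun hmem => hv ?_⟩
    have hle : Submodule.span K (Set.range fun i : Fin (s + 1) => (J ^ (i : ℕ)) (J v))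
        ≤ LinearMap.ker (J ^ (s + 1)) := by
      refine Submodule.span_le.2 ?_
      rintro _ ⟨i, rfl⟩
      change (J ^ (s + 1)) ((J ^ (i : ℕ)) (J v)) = 0
      rw [hJv, ← Module.End.mul_apply, ← pow_add,
        show s + 1 + ((i : ℕ) + 1) = i + (s + 1 + 1) by omega, pow_add, Module.End.mul_apply,
        hv', map_zero]
    exact hle hmem

theorem linearIndependent_pow_apply_of_isNilpotent {J : Module.End K V} (hJ : IsNilpotent J)
    (s : ℕ) {v : V} (hv : (J ^ s) v ≠ 0) :
    LinearIndependent K fun i : Fin (s + 1) => (J ^ (i : ℕ)) v := by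
  classical
  have hex : ∃ n, (J ^ n) v = 0 := hJ.imp fun n hn => by simp [hn]
  have hzero : ∀ n, Nat.find hex ≤ n → (J ^ n) v = 0 := fun n hn => by
    rw [← Nat.sub_add_cancel hn, pow_add, Module.End.mul_apply, Nat.find_spec hex, map_zero]
  have hlt : s < Nat.find hex := by
    by_contra! h
    exact hv (hzero s h)
  have hli := linearIndependent_jordan_chain (J := J) (Nat.find hex - 1) (v := v)
    (Nat.find_min hex (by omega)) (hzero _ (by omega))
  exact hli.comp (Fin.castLE (by omega)) (Fin.castLE_injective _)

/-- A functional dual to the top of a Jordan chain. -/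
theorem exists_dual_jordan_chain {J : Module.End K V} {r : ℕ} (hJ : J ^ (r + 1) = 0)
    (hr : J ^ r ≠ 0) :
    ∃ (e : V) (ξ : V →ₗ[K] K), ξ ((J ^ r) e) = 1 ∧ ∀ l < r, ξ ((J ^ l) e) = 0 := by
  obtain ⟨e, he⟩ : ∃ e, (J ^ r) e ≠ 0 := by
    by_contra! h
    exact hr (LinearMap.ext h)
  obtain ⟨η, hη⟩ := Module.Projective.exists_dual_ne_zero K he
  refine ⟨e, ?_⟩
  -- Triangular correction: the values at `J ^ l e` are killed from `l = r - 1` downwards, by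
  -- subtracting multiples of `ξ ∘ J ^ (s + 1)`, which do not disturb the values already fixed.
  have step : ∀ s ≤ r, ∃ ξ : V →ₗ[K] K, ξ ((J ^ r) e) = 1 ∧
      ∀ l < r, r ≤ l + s → ξ ((J ^ l) e) = 0 := by
    intro s
    induction s with
    | zero =>
      intro _
      refine ⟨(η ((J ^ r) e))⁻¹ • η, by simp [hη], fun l hl hl' => by omega⟩
    | succ s ih =>
      intro hs
      obtain ⟨ξ, h1, h0⟩ := ih (by omega)
      have hcomp : ∀ l, (ξ ∘ₗ J ^ (s + 1)) ((J ^ l) e) = ξ ((J ^ (s + 1 + l)) e) := fun l => by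
        simp [pow_add]
      have hbig : ∀ l, r < l → J ^ l = 0 := fun l hl => pow_eq_zero_of_le hl hJ
      refine ⟨ξ - ξ ((J ^ (r - (s + 1))) e) • (ξ ∘ₗ J ^ (s + 1)), ?_, fun l hl hl' => ?_⟩
      · rw [LinearMap.sub_apply, LinearMap.smul_apply, hcomp, hbig (s + 1 + r) (by omega), h1]
        simp
      · rw [LinearMap.sub_apply, LinearMap.smul_apply, hcomp]
        rcases Nat.lt_or_ge l (r - s) with h | h
        · obtain rfl : l = r - (s + 1) := by omega
          rw [show s + 1 + (r - (s + 1)) = r by omega, h1]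
          simp
        · rw [hbig (s + 1 + l) (by omega), h0 l hl (by omega)]
          simp
  obtain ⟨ξ, h1, h0⟩ := step r le_rfl
  exact ⟨ξ, h1, fun l hl => h0 l hl (by omega)⟩

end CyclicVectors

/-! ### The stable complement of a longest Jordan chain -/

section JordanComplement

variable {K V : Type*} [Field K] [AddCommGroup V] [Module K V]

/-- The largest `J`-stable subspace in the kernel of the functional `ξ`. -/
def stableKer (J : Module.End K V) (ξ : V →ₗ[K] K) : Submodule K V where
  carrier := {v | ∀ l : ℕ, ξ ((J ^ l) v) = 0}
  add_mem' ha hb l := by simp [ha l, hb l]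
  zero_mem' l := by simp
  smul_mem' c v hv l := by simp [hv l]

theorem pow_apply_mem_stableKer {J : Module.End K V} {ξ : V →ₗ[K] K} {v : V}
    (hv : v ∈ stableKer J ξ) (a : ℕ) : (J ^ a) v ∈ stableKer J ξ := fun l => by
  rw [← Module.End.mul_apply, ← pow_add]
  exact hv _

theorem apply_mem_stableKer {J : Module.End K V} {ξ : V →ₗ[K] K} {v : V}
    (hv : v ∈ stableKer J ξ) : J v ∈ stableKer J ξ := by
  simpa using pow_apply_mem_stableKer hv 1

theorem sandwichSum_smulRight_apply (J : Module.End K V) (ξ : V →ₗ[K] K) (e : V) (s : ℕ) (v : V) :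
    sandwichSum J (ξ.smulRight e) s v
      = ∑ l ∈ Finset.range s, ξ ((J ^ (s - 1 - l)) v) • (J ^ l) e := by
  simp [sandwichSum, LinearMap.sum_apply]

theorem sandwichSum_smulRight_apply_eq_zero {J : Module.End K V} {ξ : V →ₗ[K] K} (e : V) (s : ℕ)
    {v : V} (hv : v ∈ stableKer J ξ) : sandwichSum J (ξ.smulRight e) s v = 0 := by
  rw [sandwichSum_smulRight_apply]
  exact Finset.sum_eq_zero fun l _ => by rw [hv, zero_smul]

variable {J : Module.End K V} {ξ : V →ₗ[K] K} {e : V} {r : ℕ}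

/-- The sandwich sum of length `r + 1` is the projection onto the chain along `stableKer J ξ`:
duality leaves only the term with `l + b = r`. -/
theorem sub_sandwichSum_mem_stableKer (hJ : J ^ (r + 1) = 0) (h1 : ξ ((J ^ r) e) = 1)
    (h0 : ∀ l < r, ξ ((J ^ l) e) = 0) (v : V) :
    v - sandwichSum J (ξ.smulRight e) (r + 1) v ∈ stableKer J ξ := by
  intro l
  have hbig : ∀ l, r < l → J ^ l = 0 := fun l hl => pow_eq_zero_of_le hl hJ
  rw [map_sub, map_sub, sandwichSum_smulRight_apply]
  simp only [map_sum, map_smul, smul_eq_mul, ← Module.End.mul_apply, ← pow_add]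
  rcases Nat.lt_or_ge r l with h | h
  · simp only [hbig l h, pow_add, zero_mul]
    simp
  · rw [Finset.sum_eq_single (r - l)]
    · rw [show l + (r - l) = r by omega, show r + 1 - 1 - (r - l) = l by omega, h1]
      simp
    · intro b hb hbl
      have hb := Finset.mem_range.1 hb
      rcases Nat.lt_or_ge r (l + b) with h' | h'
      · simp [hbig _ h']
      · rw [h0 (l + b) (by omega), mul_zero]
    · intro h'
      exact absurd (Finset.mem_range.2 (by omega)) h'

theorem finrank_stableKer_add_le [FiniteDimensional K V] (hJ : J ^ (r + 1) = 0)
    (h1 : ξ ((J ^ r) e) = 1) (h0 : ∀ l < r, ξ ((J ^ l) e) = 0) :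
    Module.finrank K (stableKer J ξ) + (r + 1) ≤ Module.finrank K V := by
  have hbig : ∀ l, r < l → J ^ l = 0 := fun l hl => pow_eq_zero_of_le hl hJ
  have hre : (J ^ r) e ≠ 0 := fun h => by simp [h] at h1
  have hli := linearIndependent_jordan_chain r hre (by simp [hJ])
  have hS := finrank_span_eq_card hli
  set S := Submodule.span K (Set.range fun i : Fin (r + 1) => (J ^ (i : ℕ)) e) with hSdef
  rw [Fintype.card_fin] at hS
  have hdisj : Disjoint (stableKer J ξ) S := by
    rw [Submodule.disjoint_def]
    intro v hv hvS
    have hproj : ∀ w ∈ S, sandwichSum J (ξ.smulRight e) (r + 1) w = w := by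
      intro w hw
      refine LinearMap.eqOn_span (f := sandwichSum J (ξ.smulRight e) (r + 1))
        (g := LinearMap.id) ?_ hw
      rintro _ ⟨i, rfl⟩
      have hi := i.2
      simp only [LinearMap.id_apply]
      rw [sandwichSum_smulRight_apply]
      simp only [← Module.End.mul_apply, ← pow_add]
      rw [Finset.sum_eq_single (i : ℕ)]
      · rw [show r + 1 - 1 - (i : ℕ) + i = r by omega, h1, one_smul]
      · intro b hb hbl
        have hb := Finset.mem_range.1 hb
        rcases Nat.lt_or_ge r (r + 1 - 1 - b + i) with h' | h'
        · rw [hbig _ h', LinearMap.zero_apply, map_zero, zero_smul]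
        · rw [h0 _ (by omega), zero_smul]
      · intro h'
        exact absurd (Finset.mem_range.2 hi) h'
    rw [← hproj v hvS, sandwichSum_smulRight_apply_eq_zero e _ hv]
  have := Submodule.finrank_add_finrank_le_of_disjoint hdisj
  omega

theorem pow_apply_eq_zero_of_mem [FiniteDimensional K V] (hJ : IsNilpotent J) {W : Submodule K V}
    (hW : ∀ w ∈ W, J w ∈ W) {s : ℕ} (hs : Module.finrank K W ≤ s) {w : V} (hw : w ∈ W) :
    (J ^ s) w = 0 := by
  by_contra h
  have hli := linearIndependent_pow_apply_of_isNilpotent hJ s h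
  have hpow : ∀ i : ℕ, (J ^ i) w ∈ W := fun i => by
    induction i with
    | zero => simpa
    | succ i ih => rw [pow_succ', Module.End.mul_apply]; exact hW _ ih
  have hli' : LinearIndependent K fun i : Fin (s + 1) => (⟨(J ^ (i : ℕ)) w, hpow i⟩ : W) :=
    LinearIndependent.of_comp W.subtype hli
  have := hli'.fintype_card_le_finrank
  rw [Fintype.card_fin] at this
  omega

/-- On `W` the range of `J` lies in its kernel, so by rank-nullity twice the rank is at most 3, and
the range is at most a line. -/
theorem exists_smul_of_sq_eq_zero [FiniteDimensional K V] {W : Submodule K V}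
    (hW : ∀ w ∈ W, J w ∈ W) (h3 : Module.finrank K W ≤ 3) (hsq : ∀ w ∈ W, (J ^ 2) w = 0) :
    ∃ z ∈ W, ∀ w ∈ W, ∃ c : K, J w = c • z := by
  set g : Module.End K W := J.restrict hW with hg
  have hle : LinearMap.range g ≤ LinearMap.ker g := by
    rintro _ ⟨w, rfl⟩
    refine LinearMap.mem_ker.2 (Subtype.ext ?_)
    have := hsq w w.2
    rw [pow_two, Module.End.mul_apply] at this
    simpa [hg] using this
  have hrk := LinearMap.finrank_range_add_finrank_ker g
  have hmono := Submodule.finrank_mono hle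
  obtain ⟨z, hz⟩ := finrank_le_one_iff.1 (show Module.finrank K (LinearMap.range g) ≤ 1 by omega)
  refine ⟨z.1.1, z.1.2, fun w hw => ?_⟩
  obtain ⟨c, hc⟩ := hz ⟨g ⟨w, hw⟩, LinearMap.mem_range_self _ _⟩
  refine ⟨c, ?_⟩
  have := congrArg (fun u : LinearMap.range g => (u.1.1 : V)) hc
  simpa [hg] using this.symm

theorem exists_cyclic_of_sq_ne_zero [FiniteDimensional K V] (hJ : IsNilpotent J)
    {W : Submodule K V} (hW : ∀ w ∈ W, J w ∈ W) (h3 : Module.finrank K W ≤ 3) {f : V} (hf : f ∈ W)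
    (hsq : (J ^ 2) f ≠ 0) :
    ∀ w ∈ W, ∃ a b c : K, w = a • f + b • J f + c • (J ^ 2) f := by
  have hli := linearIndependent_pow_apply_of_isNilpotent hJ 2 hsq
  have hS := finrank_span_eq_card hli
  rw [Fintype.card_fin] at hS
  have hpow : ∀ i : ℕ, (J ^ i) f ∈ W := fun i => by
    induction i with
    | zero => simpa
    | succ i ih => rw [pow_succ', Module.End.mul_apply]; exact hW _ ih
  have hle : Submodule.span K (Set.range fun i : Fin (2 + 1) => (J ^ (i : ℕ)) f) ≤ W := by
    refine Submodule.span_le.2 ?_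
    rintro _ ⟨i, rfl⟩
    exact hpow i
  have hmono := Submodule.finrank_mono hle
  have heq := Submodule.eq_of_le_of_finrank_le hle (by omega)
  intro w hw
  rw [← heq] at hw
  obtain ⟨c, hc⟩ := (Submodule.mem_span_range_iff_exists_fun K).1 hw
  refine ⟨c 0, c 1, c 2, ?_⟩
  rw [← hc, Fin.sum_univ_three]
  simp

end JordanComplement

/-! ### The symmetry `y P y' = y' P y` -/

section KeyIdentity

variable {K V : Type*} [Field K] [AddCommGroup V] [Module K V]
  {J : Module.End K V} {ξ : V →ₗ[K] K} {e : V} {r : ℕ}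

theorem apply_pow_apply_mem_stableKer {y : Module.End K V} (hy : Commute J y)
    (hye : y e ∈ stableKer J ξ) (l : ℕ) : y ((J ^ l) e) ∈ stableKer J ξ := by
  rw [← Module.End.mul_apply, ← (hy.pow_left l).eq, Module.End.mul_apply]
  exact pow_apply_mem_stableKer hye l

theorem apply_sandwichSum_mem_stableKer {y : Module.End K V} (hy : Commute J y)
    (hye : y e ∈ stableKer J ξ) (s : ℕ) (v : V) :
    y (sandwichSum J (ξ.smulRight e) s v) ∈ stableKer J ξ := by
  rw [sandwichSum_smulRight_apply, map_sum]
  refine Submodule.sum_mem _ fun l _ => ?_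
  rw [map_smul]
  exact Submodule.smul_mem _ _ (apply_pow_apply_mem_stableKer hy hye l)

/-- `J w`, `J (y e)` and `J (y' e)` are all multiples of one vector `z`, and applying `ξ` to `y' J y
e = y J y' e` relates the coefficients. -/
theorem dual_smul_comm_of_sq_eq_zero [FiniteDimensional K V]
    (h3 : Module.finrank K (stableKer J ξ) ≤ 3)
    (hsq : ∀ w ∈ stableKer J ξ, (J ^ 2) w = 0)
    {y y' : Module.End K V} (hy : Commute J y) (hy' : Commute J y') (hyy' : Commute y y')
    (hye : y e ∈ stableKer J ξ) (hye' : y' e ∈ stableKer J ξ) {w : V} (hw : w ∈ stableKer J ξ) :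
    ξ (y' (J w)) • J (y e) = ξ (y (J w)) • J (y' e) := by
  obtain ⟨z, -, hz⟩ := exists_smul_of_sq_eq_zero (fun _ => apply_mem_stableKer) h3 hsq
  obtain ⟨c, hc⟩ := hz w hw
  obtain ⟨b, hb⟩ := hz _ hye
  obtain ⟨b', hb'⟩ := hz _ hye'
  have hsymm : y' (J (y e)) = y (J (y' e)) := by
    simp only [← Module.End.mul_apply]
    rw [hy.eq, ← mul_assoc, ← hyy'.eq, hy'.eq, mul_assoc]
  have hξ := congrArg ξ hsymm
  rw [hb, hb'] at hξ
  simp only [map_smul, smul_eq_mul] at hξ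
  rw [hc, hb, hb']
  simp only [map_smul, smul_smul, smul_eq_mul]
  congr 1
  linear_combination c * hξ

/-- Expand `y e`, `y' e` and `w` in `f, J f, J ^ 2 f`. Applying `ξ`, `ξ J` and `ξ J ^ 2` to `y' y e
= y y' e` yields three scalar relations, whose combinations with the coefficients of `w` match the
two sides. -/
theorem dual_smul_comm_of_cyclic {f : V} (hf3 : J (J (J f)) = 0)
    {y y' : Module.End K V} (hy : Commute J y) (hy' : Commute J y') (hyy' : Commute y y')
    (hcyc : ∀ w ∈ stableKer J ξ, ∃ a b c : K, w = a • f + b • J f + c • J (J f))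
    (hye : y e ∈ stableKer J ξ) (hye' : y' e ∈ stableKer J ξ) {w : V} (hw : w ∈ stableKer J ξ) :
    ξ (J (J (y' w))) • y e + ξ (J (y' w)) • J (y e) + ξ (y' w) • J (J (y e))
      = ξ (J (J (y w))) • y' e + ξ (J (y w)) • J (y' e) + ξ (y w) • J (J (y' e)) := by
  have cy : ∀ v, y (J v) = J (y v) := fun v => (LinearMap.congr_fun hy.eq v).symm
  have cy' : ∀ v, y' (J v) = J (y' v) := fun v => (LinearMap.congr_fun hy'.eq v).symm
  obtain ⟨a, b, c, h⟩ := hcyc _ hye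
  obtain ⟨a', b', c', h'⟩ := hcyc _ hye'
  obtain ⟨α, β, γ, hα⟩ := hcyc w hw
  have hsymm : y' (y e) = y (y' e) := (LinearMap.congr_fun hyy'.eq e).symm
  have j3 : J (J (J (y f))) = 0 := by rw [← cy, ← cy, ← cy, hf3, map_zero]
  have j3' : J (J (J (y' f))) = 0 := by rw [← cy', ← cy', ← cy', hf3, map_zero]
  rw [h, h'] at hsymm
  have e0 := congrArg ξ hsymm
  have e1 := congrArg (fun v => ξ (J v)) hsymm
  have e2 := congrArg (fun v => ξ (J (J v))) hsymm
  simp only [map_add, map_smul, cy, cy', j3, j3', smul_zero, add_zero, smul_eq_mul]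
    at e0 e1 e2
  rw [h, h', hα]
  simp only [map_add, map_smul, cy, cy', j3, j3', hf3, smul_zero, add_zero, smul_eq_mul]
  match_scalars
  · linear_combination α * e2
  · linear_combination α * e1 + β * e2
  · linear_combination α * e0 + β * e1 + γ * e2

theorem mul_sandwichSum_mul_comm [FiniteDimensional K V] (hV : Module.finrank K V ≤ 7)
    (hr : 3 ≤ r) (hJ : J ^ (r + 1) = 0) (h1 : ξ ((J ^ r) e) = 1) (h0 : ∀ l < r, ξ ((J ^ l) e) = 0)
    {y y' : Module.End K V} (hy : Commute J y) (hy' : Commute J y') (hyy' : Commute y y')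
    (hye : y e ∈ stableKer J ξ) (hye' : y' e ∈ stableKer J ξ) :
    y * sandwichSum J (ξ.smulRight e) r * y' = y' * sandwichSum J (ξ.smulRight e) r * y := by
  have hnil : IsNilpotent J := ⟨_, hJ⟩
  have hdim := finrank_stableKer_add_le hJ h1 h0
  have hstab : ∀ w ∈ stableKer J ξ, J w ∈ stableKer J ξ := fun _ => apply_mem_stableKer
  have hpow : ∀ {s : ℕ}, Module.finrank K (stableKer J ξ) ≤ s → ∀ w ∈ stableKer J ξ,
      (J ^ s) w = 0 := fun hs w hw => pow_apply_eq_zero_of_mem hnil hstab hs hw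
  have hker : ∀ w ∈ stableKer J ξ,
      y (sandwichSum J (ξ.smulRight e) r (y' w)) = y' (sandwichSum J (ξ.smulRight e) r (y w)) := by
    intro w hw
    rw [sandwichSum_smulRight_apply, sandwichSum_smulRight_apply]
    have comm : ∀ {x : Module.End K V}, Commute J x → ∀ l v, (J ^ l) (x v) = x ((J ^ l) v) :=
      fun hx l v => LinearMap.congr_fun (hx.pow_left l).eq v
    simp only [map_sum, map_smul, ← comm hy, ← comm hy']
    -- If `r > 3` then `dim W ≤ 2`, so `J ^ 2 = 0` on `W`; since `l ≥ 2` or `r - 1 - l ≥ 2`, every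
    -- term vanishes.
    rcases Nat.lt_or_ge 3 r with h | h
    · have hz : ∀ l, 2 ≤ l → ∀ w ∈ stableKer J ξ, (J ^ l) w = 0 := fun l hl w hw => by
        rw [← Nat.sub_add_cancel hl, pow_add, Module.End.mul_apply, hpow (s := 2) (by omega) w hw,
          map_zero]
      rw [Finset.sum_eq_zero, Finset.sum_eq_zero]
      all_goals
        intro l _
        rcases Nat.lt_or_ge l 2 with hl | hl
        · rw [comm (by assumption), hz (r - 1 - l) (by omega) w hw, map_zero, map_zero, zero_smul]
        · rw [hz l hl _ (by assumption), smul_zero]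
    · obtain rfl : r = 3 := le_antisymm h hr
      have hsum : ∀ u v : V, ∑ l ∈ Finset.range 3, ξ ((J ^ (3 - 1 - l)) u) • (J ^ l) v
          = ξ (J (J u)) • v + ξ (J u) • J v + ξ u • J (J v) := fun u v => by
        simp [Finset.sum_range_succ, pow_two]
      rw [hsum, hsum]
      -- Here `r = 3` and `dim W ≤ 3`: either `J ^ 2 = 0` on `W` and only the middle term survives,
      -- or `W` is cyclic under `J`.
      by_cases hsq : ∀ w ∈ stableKer J ξ, (J ^ 2) w = 0
      · have hsq' : ∀ w ∈ stableKer J ξ, J (J w) = 0 := fun w hw => by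
          simpa [pow_two] using hsq w hw
        have cy : ∀ v, J (y v) = y (J v) := LinearMap.congr_fun hy.eq
        have cy' : ∀ v, J (y' v) = y' (J v) := LinearMap.congr_fun hy'.eq
        rw [hsq' _ hye, hsq' _ hye', cy w, cy' w, cy (J w), cy' (J w), hsq' w hw]
        simpa using dual_smul_comm_of_sq_eq_zero (by omega) hsq hy hy' hyy' hye hye' hw
      · push Not at hsq
        obtain ⟨f, hf, hfsq⟩ := hsq
        have hcyc := exists_cyclic_of_sq_ne_zero hnil hstab (by omega) hf hfsq
        refine dual_smul_comm_of_cyclic (f := f) ?_ hy hy' hyy' ?_ hye hye' hw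
        · simpa [pow_succ] using hpow (s := 3) (by omega) f hf
        · simpa [pow_two] using hcyc
  -- It suffices to work on `W`: both sides vanish on the chain, since `y` and `y'` send it into
  -- `W`, which the sandwich sum kills.
  refine LinearMap.ext fun v => ?_
  have hv := hker _ (sub_sandwichSum_mem_stableKer hJ h1 h0 v)
  simp only [map_sub] at hv
  rw [sandwichSum_smulRight_apply_eq_zero e r (apply_sandwichSum_mem_stableKer hy' hye' (r + 1) v),
    sandwichSum_smulRight_apply_eq_zero e r (apply_sandwichSum_mem_stableKer hy hye (r + 1) v)]
    at hv
  simpa using hv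

end KeyIdentity

/-! ### Building the deformation and detecting its eigenvalues -/

section Deformation

variable {K V : Type*} [Field K] [AddCommGroup V] [Module K V]

open Polynomial in
theorem commute_aeval_left {A : Type*} [Ring A] [Algebra K A] {a z : A} (q : K[X])
    (hz : Commute a z) : Commute (aeval a q) z := by
  induction q using Polynomial.induction_on' with
  | add f g hf hg => rw [map_add]; exact hf.add_left hg
  | monomial n c =>
    rw [aeval_monomial]
    exact (show Commute _ _ from Algebra.commutes c z).mul_left (hz.pow_left n)

open Polynomial in
theorem exists_deformation [FiniteDimensional K V] (hV : Module.finrank K V ≤ 7)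
    {ι : Type*} [Fintype ι] (x : ι → Module.End K V) (hx : ∀ i j, Commute (x i) (x j))
    (c : ι → K) {J : Module.End K V} (hJc : ∑ i, c i • x i = J) (hnil : IsNilpotent J)
    (hcube : J ^ 3 ≠ 0) :
    ∃ (E P : Module.End K V) (y : ι → Module.End K V) (p : ι → K[X]) (a b : V),
      (∀ i, x i = aeval J (p i) + y i) ∧ (∑ i, c i • p i = X) ∧ (∑ i, c i • y i = 0) ∧
      (∀ i, J * y i = y i * J) ∧ (∀ i, E * y i = J * (P * y i) - P * y i * J) ∧
      (∀ i, y i * E = 0) ∧ E * P = 0 ∧ (∀ i j, y i * y j = y j * y i) ∧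
      (∀ i j, y i * P * y j = y j * P * y i) ∧ (∀ i, P * y i * P = 0) ∧
      a ≠ 0 ∧ (J + E) a = a ∧ b ≠ 0 ∧ (J + E) b = 0 := by
  classical
  have hxJ : ∀ i, Commute J (x i) := fun i => by
    rw [← hJc]
    exact Commute.sum_left _ _ _ fun j _ => (hx j i).smul_left _
  obtain ⟨r, hr, hJ, hJr⟩ : ∃ r, 3 ≤ r ∧ J ^ (r + 1) = 0 ∧ J ^ r ≠ 0 := by
    have hlt : 3 < Nat.find hnil := by
      by_contra! h
      exact hcube (pow_eq_zero_of_le h (Nat.find_spec hnil))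
    refine ⟨Nat.find hnil - 1, by omega, ?_, Nat.find_min hnil (by omega)⟩
    rw [Nat.sub_add_cancel (by omega)]
    exact Nat.find_spec hnil
  obtain ⟨e, ξ, h1, h0⟩ := exists_dual_jordan_chain hJ hJr
  set R : Module.End K V := ξ.smulRight e with hR
  have hRv : ∀ v, R v = ξ v • e := fun v => rfl
  have hdim := finrank_stableKer_add_le hJ h1 h0
  have hstab : ∀ w ∈ stableKer J ξ, J w ∈ stableKer J ξ := fun _ => apply_mem_stableKer
  have hWr : ∀ w ∈ stableKer J ξ, (J ^ r) w = 0 := fun w hw =>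
    pow_apply_eq_zero_of_mem hnil hstab (by omega) hw
  -- The coefficients are chosen so that `p i (J) e` is the chain component of `x i e`, which puts
  -- `y i e` in `W`.
  set p : ι → K[X] := fun i =>
    ∑ l ∈ Finset.range (r + 1), ξ ((J ^ (r - l)) (x i e)) • X ^ l with hp
  set y : ι → Module.End K V := fun i => x i - aeval J (p i) with hy
  have hpe : ∀ i, aeval J (p i) e = sandwichSum J R (r + 1) (x i e) := fun i => by
    rw [sandwichSum_smulRight_apply, hp]
    simp [LinearMap.sum_apply]
  have hye : ∀ i, y i e ∈ stableKer J ξ := fun i => by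
    rw [hy, LinearMap.sub_apply, hpe]
    exact sub_sandwichSum_mem_stableKer hJ h1 h0 _
  have hJy : ∀ i, Commute J (y i) := fun i =>
    (hxJ i).sub_right (commute_aeval_left _ (Commute.refl J)).symm
  have hyy : ∀ i j, Commute (y i) (y j) := fun i j =>
    ((hx i j).sub_right (commute_aeval_left _ (hxJ i)).symm).sub_left (commute_aeval_left _ (hJy j))
  have hpsum : ∑ i, c i • p i = X := by
    have : ∀ l, ∑ i, c i • ξ ((J ^ (r - l)) (x i e)) = ξ ((J ^ (r - l + 1)) e) := fun l => by
      rw [pow_succ, Module.End.mul_apply]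
      nth_rewrite 3 [← hJc]
      simp [LinearMap.sum_apply]
    simp only [hp, Finset.smul_sum]
    rw [Finset.sum_comm]
    simp only [← smul_assoc, ← Finset.sum_smul, this]
    rw [Finset.sum_eq_single 1]
    · rw [Nat.sub_add_cancel (by omega), h1]
      simp
    · intro l hl hl1
      have hl := Finset.mem_range.1 hl
      rcases Nat.eq_zero_or_pos l with rfl | hpos
      · simp [hJ]
      · rw [h0 _ (by omega), zero_smul]
    · intro h
      exact absurd (Finset.mem_range.2 (by omega)) h
  -- `J ^ r` kills `W`, so `v` may be replaced by its chain component, which `y i` sends into `W`.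
  have hlast : ∀ i v, ξ ((J ^ r) (y i v)) = 0 := fun i v => by
    have hw := hWr _ (sub_sandwichSum_mem_stableKer hJ h1 h0 v)
    have hπ := apply_sandwichSum_mem_stableKer (hJy i) (hye i) (r + 1) v r
    have hc : ∀ u, (J ^ r) (y i u) = y i ((J ^ r) u) :=
      LinearMap.congr_fun ((hJy i).pow_left r).eq
    rw [map_sub, sub_eq_zero] at hw
    rw [hc, hw, ← hc]
    exact hπ
  have hPW : ∀ i, sandwichSum J R r * y i * sandwichSum J R r = 0 := fun i =>
    LinearMap.ext fun v => sandwichSum_smulRight_apply_eq_zero e r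
      (apply_sandwichSum_mem_stableKer (hJy i) (hye i) r v)
  refine ⟨J ^ r * R, sandwichSum J R r, y, p, (J ^ r) e, (J ^ r) e - (J ^ (r - 1)) e,
    fun i => by simp [hy], hpsum, ?_, fun i => (hJy i).eq, fun i => ?_, fun i => ?_, ?_,
    fun i j => (hyy i j).eq,
    fun i j => mul_sandwichSum_mul_comm hV hr hJ h1 h0 (hJy i) (hJy j) (hyy i j) (hye i) (hye j),
    hPW, fun h => by simp [h] at h1, ?_, fun h => ?_, ?_⟩
  · have := congrArg (aeval J) hpsum
    simp only [map_sum, map_smul, aeval_X] at this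
    simp only [hy, smul_sub, Finset.sum_sub_distrib, this, hJc, sub_self]
  -- The commutator of `J` and `P` is `E - R J ^ r`, and `R J ^ r y i = 0` by `hlast`.
  · have hcomm := (sandwichSum_succ J R r).symm.trans (sandwichSum_succ' J R r)
    have hzero : R * J ^ r * y i = 0 := LinearMap.ext fun v => by
      change R ((J ^ r) (y i v)) = 0
      rw [hRv, hlast, zero_smul]
    have := congrArg (· * y i) hcomm
    simp only [add_mul, hzero, add_zero] at this
    rw [mul_assoc _ (y i) J, ← (hJy i).eq, ← mul_assoc, ← mul_assoc, ← this]
    abel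
  · refine LinearMap.ext fun v => ?_
    change y i ((J ^ r) (R v)) = 0
    rw [hRv, map_smul, map_smul, ← Module.End.mul_apply, ← ((hJy i).pow_left r).eq,
      Module.End.mul_apply, hWr _ (hye i), smul_zero]
  · refine LinearMap.ext fun v => ?_
    change (J ^ r) (R (sandwichSum J R r v)) = 0
    rw [hRv, sandwichSum_smulRight_apply, map_sum, Finset.sum_eq_zero, zero_smul, map_zero]
    intro l hl
    rw [map_smul, h0 l (Finset.mem_range.1 hl), smul_zero]
  · change J ((J ^ r) e) + (J ^ r) (R ((J ^ r) e)) = (J ^ r) e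
    rw [hRv, h1, one_smul, ← Module.End.mul_apply J, ← pow_succ', hJ]
    simp
  · have := congrArg ξ h
    rw [map_sub, h1, h0 _ (by omega), map_zero, sub_zero] at this
    exact one_ne_zero this
  · change J ((J ^ r) e - (J ^ (r - 1)) e) + (J ^ r) (R ((J ^ r) e - (J ^ (r - 1)) e)) = 0
    rw [hRv, map_sub, map_sub, h1, h0 _ (by omega), ← Module.End.mul_apply J,
      ← Module.End.mul_apply J, ← pow_succ', ← pow_succ', hJ, Nat.sub_add_cancel (by omega)]
    simp

/-- Over an algebraically closed field the generalized eigenspaces span, so the one at `μ` is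
everything. -/
theorem isNilpotent_sub_of_existsUnique_hasEigenvalue [IsAlgClosed K] [FiniteDimensional K V]
    {f : Module.End K V} {μ : K} (h : ∀ ν, f.HasEigenvalue ν → ν = μ) :
    IsNilpotent (f - algebraMap K (Module.End K V) μ) := by
  have htop : f.maxGenEigenspace μ = ⊤ := by
    rw [eq_top_iff, ← Module.End.iSup_maxGenEigenspace_eq_top f]
    refine iSup_le fun ν => ?_
    by_cases hν : ν = μ
    · rw [hν]
    · have hev : ¬ f.HasEigenvalue ν := fun h' => hν (h ν h')
      have : f.maxGenEigenspace ν = ⊥ := by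
        by_contra hne
        refine hev (Module.End.HasUnifEigenvalue.lt (k := ⊤) (by simp) ?_)
        exact hne
      rw [this]
      exact bot_le
  refine ⟨Module.finrank K V, LinearMap.ext fun v => ?_⟩
  have hv : v ∈ f.maxGenEigenspace μ := htop ▸ Submodule.mem_top
  rw [Module.End.maxGenEigenspace_eq_genEigenspace_finrank, Module.End.mem_genEigenspace_nat] at hv
  simpa [Algebra.algebraMap_eq_smul_one] using hv

/-- In a commuting family of operators with one eigenvalue each, every linear combination has at
most one eigenvalue. -/
theorem eigenvalue_eq_of_sum_smul [IsAlgClosed K] [FiniteDimensional K V] {ι : Type*} [Fintype ι]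
    {x : ι → Module.End K V} (hx : ∀ i j, Commute (x i) (x j))
    (h : ∀ i, ∃! μ, (x i).HasEigenvalue μ) (c : ι → K) {α : K} {a : V} (ha : a ≠ 0)
    (hα : (∑ i, c i • x i) a = α • a) {β : K} {b : V} (hb : b ≠ 0)
    (hβ : (∑ i, c i • x i) b = β • b) : α = β := by
  choose μ _ hμ using h
  -- The only candidate eigenvalue: the combination minus `s` is a sum of commuting nilpotents.
  set s := ∑ i, c i * μ i with hs
  have hnil : IsNilpotent ((∑ i, c i • x i) - algebraMap K (Module.End K V) s) := by
    have : (∑ i, c i • x i) - algebraMap K (Module.End K V) s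
        = ∑ i, c i • (x i - algebraMap K (Module.End K V) (μ i)) := by
      simp only [smul_sub, Finset.sum_sub_distrib, hs, map_sum, Algebra.algebraMap_eq_smul_one,
        smul_smul]
    rw [this]
    refine Commute.isNilpotent_sum (fun i _ => ?_) fun i j _ _ => ?_
    · exact (isNilpotent_sub_of_existsUnique_hasEigenvalue (hμ i)).smul _
    · refine Commute.smul_left (Commute.smul_right ?_ _) _
      exact ((hx i j).sub_right (Algebra.commutes _ _).symm).sub_left
        ((Algebra.commutes _ _ : Commute _ _))
  have key : ∀ {γ : K} {v : V}, v ≠ 0 → (∑ i, c i • x i) v = γ • v → γ = s := by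
    intro γ v hv hγ
    have hv' : ((∑ i, c i • x i) - algebraMap K (Module.End K V) s) v = (γ - s) • v := by
      simp only [LinearMap.sub_apply, hγ, Module.algebraMap_end_apply, sub_smul]
    obtain ⟨N, hN⟩ := hnil
    have hpow : ∀ n : ℕ, (((∑ i, c i • x i) - algebraMap K (Module.End K V) s) ^ n) v
        = (γ - s) ^ n • v := fun n => by
      induction n with
      | zero => simp
      | succ n ih => rw [pow_succ, Module.End.mul_apply, hv', map_smul, ih, smul_smul, pow_succ']
    have := hpow N
    rw [hN, LinearMap.zero_apply] at this
    rcases smul_eq_zero.1 this.symm with h | h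
    · have hN0 : N ≠ 0 := fun h' => by simp [h'] at h
      exact sub_eq_zero.1 ((pow_eq_zero_iff hN0).1 h)
    · exact absurd h hv
  rw [key ha hα, key hb hβ]

end Deformation

open Polynomial in
/-- Perturbing `J` to `J + t E` and `y` to `(1 - t P) y` preserves commutativity. -/
theorem commute_deformed {K A : Type*} [Field K] [Ring A] [Algebra K A] {J E P t y y' : A}
    (ht : ∀ a, Commute t a) (q q' : K[X])
    (hJy : J * y = y * J) (hJy' : J * y' = y' * J)
    (hEy : E * y = J * (P * y) - P * y * J) (hEy' : E * y' = J * (P * y') - P * y' * J)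
    (hyE : y * E = 0) (hyE' : y' * E = 0) (hEP : E * P = 0)
    (hyy' : y * y' = y' * y) (hyPy' : y * P * y' = y' * P * y) (hPyP : P * y * P = 0)
    (hPyP' : P * y' * P = 0) :
    Commute (aeval (J + t * E) q + (1 - t * P) * y) (aeval (J + t * E) q' + (1 - t * P) * y') := by
  have hone : ∀ {y : A}, J * y = y * J → E * y = J * (P * y) - P * y * J → y * E = 0 →
      Commute (J + t * E) ((1 - t * P) * y) := by
    intro y hJy hEy hyE
    have l1 : (J + t * E) * ((1 - t * P) * y)
        = J * y + t * (E * y) - (J * t) * (P * y) - t * (E * t) * P * y := by noncomm_ring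
    have l2 : (1 - t * P) * y * (J + t * E)
        = y * J + (y * t) * E - t * (P * y * J) - t * P * (y * t) * E := by noncomm_ring
    change _ = _
    rw [l1, l2, ← (ht J).eq, ← (ht E).eq, ← (ht y).eq, hEy, hJy]
    have z1 : t * (t * E) * P * y = t * t * (E * P) * y := by noncomm_ring
    have z2 : t * P * (t * y) * E = t * P * t * (y * E) := by noncomm_ring
    have z3 : t * y * E = t * (y * E) := by noncomm_ring
    rw [z1, z2, z3, hEP, hyE]
    noncomm_ring
  have htwo : Commute ((1 - t * P) * y) ((1 - t * P) * y') := by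
    have ex : ∀ {y y' : A}, P * y * P = 0 → (1 - t * P) * y * ((1 - t * P) * y')
        = y * y' - t * (y * P * y') - t * P * (y * y') := by
      intro y y' hPyP
      have l1 : (1 - t * P) * y * ((1 - t * P) * y')
          = y * y' - (y * t) * P * y' - t * P * (y * y') + t * P * (y * t) * P * y' := by
        noncomm_ring
      have z1 : t * P * (t * y) * P * y' = t * (P * t) * y * P * y' := by noncomm_ring
      have z2 : t * (t * P) * y * P * y' = t * t * (P * y * P) * y' := by noncomm_ring
      rw [l1, ← (ht y).eq, z1, ← (ht P).eq, z2, hPyP]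
      noncomm_ring
    change _ = _
    rw [ex hPyP, ex hPyP', hyy', hyPy']
  have hq : ∀ q q' : K[X], Commute (aeval (J + t * E) q) (aeval (J + t * E) q') := fun q q' =>
    commute_aeval_left _ (commute_aeval_left _ (Commute.refl _)).symm
  refine ((hq q q').add_right (commute_aeval_left _ (hone hJy' hEy' hyE'))).add_left
    (Commute.add_right ?_ htwo)
  exact (commute_aeval_left _ (hone hJy hEy hyE)).symm

/-! ### From families to irreducible components -/

namespace CommutingMatrices

variable {k : Type*} [Field k] {n d : ℕ}

open Polynomial in
/-- All members of a polynomial one-parameter family of commuting tuples lie on a common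
irreducible component. -/
theorem exists_irreducibleComponent_of_family (M : Fin n → Matrix (Fin d) (Fin d) k[X])
    (hM : ∀ i j, M i * M j = M j * M i) :
    ∃ Z ∈ irreducibleComponents (CommutingScheme k n d),
      ∀ (s : k) (y : Fin n → Matrix (Fin d) (Fin d) k) (hy : ∀ i j, y i * y j = y j * y i),
        (∀ i, y i = (M i).map (eval s)) → point y hy ∈ Z := by
  set φ : MvPolynomial (Fin n × Fin d × Fin d) k →+* k[X] :=
    MvPolynomial.eval₂Hom C fun v => M v.1 v.2.1 v.2.2 with hφ
  have hφI : ∀ p ∈ commutatorIdeal k n d, φ p = 0 := by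
    intro p hp
    have hle : commutatorIdeal k n d ≤ RingHom.ker φ := by
      refine Ideal.span_le.2 ?_
      rintro _ ⟨i, j, a, b, rfl⟩
      have h := congrFun (congrFun (hM i j) a) b
      simp only [Matrix.mul_apply] at h
      simp [RingHom.mem_ker, genericMatrix, hφ, Matrix.mul_apply, h]
    exact hle hp
  -- The image of the generic point of the parameter line; every member of the family is a
  -- specialization of it.
  let q : CommutingScheme k n d :=
    ⟨RingHom.ker (Ideal.Quotient.lift (commutatorIdeal k n d) φ hφI), RingHom.ker_isPrime _⟩
  refine ⟨irreducibleComponent q, irreducibleComponent_mem_irreducibleComponents q,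
    fun s y hy hys => ?_⟩
  have hle : q ≤ point y hy := by
    intro f hf
    obtain ⟨f, rfl⟩ := Ideal.Quotient.mk_surjective f
    have hf' : φ f = 0 := by simpa [q, RingHom.mem_ker] using hf
    have hev : (evalRingHom s).comp φ = evalTuple y := by
      refine MvPolynomial.ringHom_ext (fun c => ?_) fun v => ?_
      · simp [hφ, evalTuple]
      · simp [hφ, evalTuple, hys]
    change _ ∈ RingHom.ker _
    rw [RingHom.mem_ker, Ideal.Quotient.lift_mk, ← hev, RingHom.comp_apply, hf', map_zero]
  have hmem := (PrimeSpectrum.le_iff_mem_closure q (point y hy)).1 hle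
  exact (isClosed_irreducibleComponent.closure_subset_iff.2
    (Set.singleton_subset_iff.2 mem_irreducibleComponent)) hmem

end CommutingMatrices

theorem mainTheorem9 {k : Type*} [Field k] [IsAlgClosed k] [CharZero k]
    (n d : ℕ) (hd : d ≤ 7)
    (x : Fin n → Matrix (Fin d) (Fin d) k)
    (hx : ∀ i j, x i * x j = x j * x i)
    (hnil : ∀ i, IsNilpotent (x i))
    (hcube : ∃ c : Fin n → k, (∑ i, c i • x i) ^ 3 ≠ 0) :
    ∃ Z ∈ irreducibleComponents (CommutingMatrices.CommutingScheme k n d),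
      CommutingMatrices.point x hx ∈ Z ∧ ¬ CommutingMatrices.IsElementary Z := by
  obtain ⟨c, hc⟩ := hcube
  set L : Matrix (Fin d) (Fin d) k ≃ₐ[k] Module.End k (Fin d → k) := Matrix.toLinAlgEquiv' with hL
  have hLx : ∀ i j, Commute (L (x i)) (L (x j)) := fun i j =>
    (show Commute (x i) (x j) from hx i j).map L
  have hJnil : IsNilpotent (L (∑ i, c i • x i)) := by
    refine IsNilpotent.map (Commute.isNilpotent_sum (fun i _ => (hnil i).smul _)
      fun i j _ _ => ?_) L
    exact Commute.smul_left (Commute.smul_right (hx i j) _) _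
  have hJcube : L (∑ i, c i • x i) ^ 3 ≠ 0 := by
    rwa [← map_pow, map_ne_zero_iff _ L.injective]
  obtain ⟨E, P, y, p, a, b, hxy, hpc, hyc, hJy, hEy, hyE, hEP, hyy, hyPy, hPyP, ha, hJa, hb, hJb⟩ :=
    exists_deformation (by simpa using hd) (fun i => L (x i)) hLx c (by simp) hJnil hJcube
  set J := L (∑ i, c i • x i) with hJ
  let Ψ : Module.End k (Fin d → k) →ₐ[k] Matrix (Fin d) (Fin d) (Polynomial k) :=
    ((Algebra.ofId k (Polynomial k)).mapMatrix).comp L.symm.toAlgHom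
  -- The deformation parameter as a scalar matrix, hence central as `commute_deformed` requires.
  let t : Matrix (Fin d) (Fin d) (Polynomial k) := algebraMap (Polynomial k) _ Polynomial.X
  let M : Fin n → Matrix (Fin d) (Fin d) (Polynomial k) := fun i =>
    Polynomial.aeval (Ψ J + t * Ψ E) (p i) + (1 - t * Ψ P) * Ψ (y i)
  have hM : ∀ i j, M i * M j = M j * M i := fun i j => by
    refine commute_deformed (fun a => Algebra.commutes _ a) (p i) (p j) ?_ ?_ ?_ ?_ ?_ ?_ ?_ ?_ ?_
      ?_ ?_ <;> simp only [← map_mul, ← map_sub, hJy, hEy, hyE, hEP, hyy i j, hyPy i j, hPyP,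
        map_zero]
  let ev : k → Matrix (Fin d) (Fin d) (Polynomial k) →ₐ[k] Matrix (Fin d) (Fin d) k := fun s =>
    (Polynomial.aeval s).mapMatrix
  have hev : ∀ s i, (M i).map (Polynomial.eval s) = ev s (M i) := fun s i => by
    ext u v
    simp [ev, Polynomial.coe_aeval_eq_eval]
  have hevΨ : ∀ s f, ev s (Ψ f) = L.symm f := fun s f => by
    ext u v
    simp [ev, Ψ]
  have hevt : ∀ s, ev s t = algebraMap k _ s := fun s => by
    ext u v
    by_cases h : u = v <;> simp [ev, t, Matrix.algebraMap_matrix_apply, h]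
  have hevM : ∀ s i, ev s (M i)
      = L.symm (Polynomial.aeval (J + s • E) (p i) + (1 - s • P) * y i) := fun s i => by
    simp only [M, map_add, map_mul, map_sub, map_one, hevΨ, hevt, ← Polynomial.aeval_algHom_apply, Algebra.smul_def,
      AlgEquiv.commutes]
  obtain ⟨Z, hZ, hmem⟩ := CommutingMatrices.exists_irreducibleComponent_of_family M hM
  refine ⟨Z, hZ, hmem 0 x hx fun i => ?_, fun helem => ?_⟩
  · rw [hev, hevM]
    simp [← hxy]
  · have hzcomm : ∀ i j, ev 1 (M i) * ev 1 (M j) = ev 1 (M j) * ev 1 (M i) := fun i j => by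
      rw [← map_mul, hM, map_mul]
    have huniq := helem (fun i => ev 1 (M i)) hzcomm (hmem 1 _ hzcomm fun i => (hev 1 i).symm)
    -- The relations `∑ c_i p_i = X` and `∑ c_i y_i = 0` leave only `J + E`.
    have hsum : ∑ i, c i • L (ev 1 (M i)) = J + E := by
      have h1 : ∀ i, L (ev 1 (M i)) = Polynomial.aeval (J + E) (p i) + (1 - P) * y i := fun i => by
        rw [hevM]; simp
      have h2 := congrArg (Polynomial.aeval (J + E)) hpc
      simp only [map_sum, map_smul, Polynomial.aeval_X] at h2
      simp only [h1, smul_add, Finset.sum_add_distrib, h2, ← mul_smul_comm, ← Finset.mul_sum, hyc,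
        mul_zero, add_zero]
    refine one_ne_zero (α := k) (eigenvalue_eq_of_sum_smul (x := fun i => L (ev 1 (M i)))
      (fun i j => (show Commute _ _ from hzcomm i j).map L) huniq c ha (β := 0) ?_ hb ?_)
    · rw [hsum, hJa, one_smul]
    · rw [hsum, hJb, zero_smul]
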